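/- \textbf{Model.} Let $K,N,N_r,K_c$ be positive integers with $N\mid K$, $N_r\le N$, $K_c\le K$, and let $M$ be a non-negative integer. Let $\mathbb F_q$ be a finite field, $L\ge 1$ an integer, and let $W_1,\dots,W_K\in\mathbb F_q^L$ (the messages, $W_k$ being the outcome of dataset $k$) be the rows of a $K\times L$ matrix $W$, and $F\in\mathbb F_q^{K_c\times K}$ the request matrix. All entries of $F$ and $W$ are independent and uniform on $\mathbb F_q$. A computation scheme consists of: for each worker $n\in[N]$, a set of datasets $\mathcal Z_n(F)\subseteq[K]$ with $|\mathcal Z_n(F)|\le M$ for every $F$; a length $T_n$ and an answer $X_n=\psi_n(F,(W_k)_{k\in\mathcal Z_n(F)})\in\mathbb F_q^{T_n}$; and, for each $\mathcal A\subseteq[N]$ with $|\mathcal A|=N_r$, a decoding function giving $\hat g_{\mathcal A}=\phi_{\mathcal A}(F,(X_n)_{n\in\mathcal A})\in\mathbb F_q^{K_c\times L}$. No linearity of these functions is assumed. Its error probability is $\varepsilon=\max_{\mathcal A}\Pr\{\hat g_{\mathcal A}\ne FW\}$ and its communication cost is $\max_{\mathcal A}\frac1L\sum_{n\in\mathcal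 A}T_n$, both maxima over $|\mathcal A|=N_r$. A number $R$ is achievable if for some message length $L\ge 1$ there are schemes, one for each finite field $\mathbb F_q$, of communication cost at most $R$ and with $\varepsilon\to0$ as $q\to\infty$. Let $C$ be the least achievable number. \textbf{Theorem (Optimality).} Let $M=\frac KN(N-N_r+1)$ (the minimum computation cost). Then in each of the following cases the minimum $C$ exists (is attained) and has the stated value: \begin{itemize} \item if $K=N$: $C=N_r$ when $1\le K_c\le N_r$, and $C=K_c$ when $N_r<K_c\le K$; \item if $1\le K_c\le\left\lceil K/\binom{N}{N-N_r+1}\right\rceil$: $C=N_rK_c$; \item if $\frac KN N_r\le K_c\le K$: $C=K_c$. \end{itemize} -/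

import Mathlib

noncomputable section

namespace LinSepComp

/-- Probability of the event `E` under the uniform distribution on the finite type `Ω`. -/
def uniformProb {Ω : Type} (E : Set Ω) : ℝ :=
  (E.ncard : ℝ) / (Nat.card Ω : ℝ)

/-- A computation scheme over the alphabet `F` for `K` messages of `L` symbols each, `N` workers,
`Kc` requested linear combinations and computation cost `M`. Its data may depend on the request
matrix `D`, which is known to the master and to all workers. -/
structure Scheme (F : Type) (K N Kc M L : ℕ) where
  /-- The set of datasets assigned to each worker. -/
  assign : Fin N → Matrix (Fin Kc) (Fin K) F → Finset (Fin K)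
  /-- No worker is assigned more than `M` datasets. -/
  card_assign_le : ∀ n D, (assign n D).card ≤ M
  /-- The number of symbols sent by each worker. -/
  len : Fin N → ℕ
  /-- The answer of a worker, a function of the request matrix and of those messages only that
  belong to the datasets assigned to the worker. -/
  encode : (n : Fin N) → (D : Matrix (Fin Kc) (Fin K) F) →
    ((k : Fin K) → k ∈ assign n D → Fin L → F) → Fin (len n) → F
  /-- The decoding function of the master for each set of responding workers. -/
  decode : (A : Finset (Fin N)) → Matrix (Fin Kc) (Fin K) F →
    ((n : Fin N) → n ∈ A → Fin (len n) → F) → Matrix (Fin Kc) (Fin L) F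

namespace Scheme

variable {F : Type} {K N Kc M L : ℕ}

/-- The answer `X_n` of worker `n` when the messages are the rows of `W`. -/
def answer (s : Scheme F K N Kc M L) (D : Matrix (Fin Kc) (Fin K) F)
    (W : Matrix (Fin K) (Fin L) F) (n : Fin N) : Fin (s.len n) → F :=
  s.encode n D (fun k _ => W k)

/-- The output of the master when the set of responding workers is `A`. -/
def output (s : Scheme F K N Kc M L) (A : Finset (Fin N)) (D : Matrix (Fin Kc) (Fin K) F)
    (W : Matrix (Fin K) (Fin L) F) : Matrix (Fin Kc) (Fin L) F :=
  s.decode A D (fun n _ => s.answer D W n)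

/-- The worst-case error probability over all sets of `Nr` responding workers. The entries of the
request matrix and all symbols of the messages are independent and uniform on `F`. -/
def errorProb [Field F] (s : Scheme F K N Kc M L) (Nr : ℕ) : ℝ :=
  ⨆ A : {A : Finset (Fin N) // A.card = Nr},
    uniformProb {p : Matrix (Fin Kc) (Fin K) F × Matrix (Fin K) (Fin L) F |
      s.output A.1 p.1 p.2 ≠ p.1 * p.2}

/-- The communication cost: the largest number of symbols, normalized by `L`, that the master
downloads from a set of `Nr` responding workers. -/
def commCost (s : Scheme F K N Kc M L) (Nr : ℕ) : ℝ :=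
  ⨆ A : {A : Finset (Fin N) // A.card = Nr}, (∑ n ∈ A.1, (s.len n : ℝ)) / (L : ℝ)

end Scheme

/-- The communication cost `R` is achievable: for some message length `L` there are computation
schemes, one for each finite field, of cost at most `R`, whose error probability tends to `0` as
the order of the field tends to infinity. -/
def Achievable (K N Nr Kc M : ℕ) (R : ℝ) : Prop :=
  ∃ L : ℕ, 0 < L ∧
    ∃ s : (F : Type) → [Field F] → [Finite F] → Scheme F K N Kc M L,
      (∀ (F : Type) [Field F] [Finite F], (s F).commCost Nr ≤ R) ∧
      ∀ δ : ℝ, 0 < δ → ∃ Q : ℕ, ∀ (F : Type) [Field F] [Finite F],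
        Q ≤ Nat.card F → (s F).errorProb Nr ≤ δ

/-- `C` is the minimum communication cost. -/
def IsMinCommCost (K N Nr Kc M : ℕ) (C : ℝ) : Prop :=
  IsLeast {R : ℝ | Achievable K N Nr Kc M R} C

end LinSepComp

end

noncomputable section

namespace LinSepComp

open MvPolynomial

/-! Write `K = N * m` and `Nr = t + 1`, so that `M = (N - t) * m`.

Upper bounds: datasets are assigned cyclically in blocks of `m`, each worker missing `t` consecutive
blocks. For a request `D` with `(t + 1) * m` rows, the columns in the missing blocks generically
span a space of dimension `t * m`. The worker sends the image of `D w` in the `m`-dimensional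
quotient, which the messages it lacks do not affect. Any `t + 1` workers determine `D w` once their
spans meet only in zero, which `jointDet` detects. This determinant is a nonzero polynomial, by a
sparse specialisation built on `exists_matching`, so Schwartz–Zippel bounds the failure probability
by a constant over the field order. The three costs come from padding the request
(`achievable_of_le`), from treating each row separately (`achievable_mul`) and from Vandermonde
coding over windows of rows (`achievable_self`).

Lower bounds: a small average error allows fixing one request with nonzero entries and maximal
minors for which each set of responders errs on less than half of the messages. If, among the
responders, only the workers in `B` hold some `c` datasets with independent request columns, then
`B` sends at least `c * L` symbols (`Scheme.mul_le_sum_len`). With `B` all responders this gives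
`Kc`. With `B` empty it shows that any `t + 1` workers cover all datasets; minimality of `M` then
makes every dataset held exactly `N - t` times, and a pigeonhole gives each worker private datasets
(`exists_private_datasets`). -/

/-! ### Uniform probability and the Schwartz–Zippel bound. -/

theorem uniformProb_mono {Ω : Type} [Finite Ω] {E E' : Set Ω} (h : E ⊆ E') :
    uniformProb E ≤ uniformProb E' := by
  unfold uniformProb
  gcongr
  exact E'.toFinite

theorem uniformProb_preimage_equiv {α β : Type} (e : α ≃ β) (E : Set β) :
    uniformProb (e ⁻¹' E) = uniformProb E := by
  unfold uniformProb
  rw [Nat.card_congr e, Set.ncard_preimage_of_injective_subset_range e.injective (by simp)]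

theorem uniformProb_preimage_fst {α β : Type} [Finite α] [Finite β] [Nonempty β] (E : Set α) :
    uniformProb {p : α × β | p.1 ∈ E} = uniformProb E := by
  unfold uniformProb
  have : {p : α × β | p.1 ∈ E} = E ×ˢ Set.univ := by ext; simp
  have hβ : (Nat.card β : ℝ) ≠ 0 := by exact_mod_cast Nat.card_pos.ne'
  rw [this, Set.ncard_prod, Set.ncard_univ, Nat.card_prod]
  push_cast
  rw [mul_div_mul_right _ _ hβ]

theorem uniformProb_eval_eq_zero_le {F : Type} [Field F] [Finite F] {ι : Type} [Finite ι]
    (P : MvPolynomial ι F) (hP : P ≠ 0) :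
    uniformProb {x : ι → F | eval x P = 0} ≤ (P.totalDegree : ℝ) / Nat.card F := by
  classical
  have := Fintype.ofFinite F
  obtain ⟨n, ⟨e⟩⟩ := Finite.exists_equiv_fin ι
  have hP' : rename e P ≠ 0 := by
    rwa [Ne, map_eq_zero_iff _ (rename_injective e e.injective)]
  have h := schwartz_zippel_totalDegree hP' (Finset.univ : Finset F)
  have hdeg : (rename e P).totalDegree ≤ P.totalDegree := totalDegree_rename_le e P
  have hE : {x : ι → F | eval x P = 0}
      = (e.arrowCongr (Equiv.refl F)) ⁻¹' {x : Fin n → F | eval x (rename e P) = 0} := by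
    ext x
    simp only [Set.mem_ofPred_eq, Set.mem_preimage, eval_rename]
    have : ((e.arrowCongr (Equiv.refl F)) x) ∘ e = x := by ext i; simp [Equiv.arrowCongr]
    rw [this]
  rw [hE, uniformProb_preimage_equiv]
  have h2 : (((Finset.univ.filter fun x : Fin n → F => eval x (rename e P) = 0).card : ℚ)) /
      (Nat.card F : ℚ) ^ n ≤ ((rename e P).totalDegree : ℚ) / Nat.card F := by
    have h3 := h
    rw [Fintype.piFinset_univ, Finset.card_univ, ← Nat.card_eq_fintype_card] at h3
    exact_mod_cast h3
  have h4 : (((Finset.univ.filter fun x : Fin n → F => eval x (rename e P) = 0).card : ℝ)) /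
      (Nat.card F : ℝ) ^ n ≤ ((rename e P).totalDegree : ℝ) / Nat.card F := by
    have h3 := (Rat.cast_le (K := ℝ)).2 h2
    push_cast at h3
    exact h3
  have h5 : {x : Fin n → F | eval x (rename e P) = 0}.ncard
      = (Finset.univ.filter fun x : Fin n → F => eval x (rename e P) = 0).card := by
    rw [← Set.ncard_coe_finset]; simp
  unfold uniformProb
  rw [h5, Nat.card_fun, Nat.card_eq_fintype_card (α := Fin n), Fintype.card_fin]
  push_cast
  refine h4.trans ?_
  gcongr

/-- With `p` also drawn uniformly, the event lies inside the zero set of `P` in all variables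
jointly. -/
theorem uniformProb_forall_eval_eq_zero_le {F : Type} [Field F] [Finite F] {α β κ : Type}
    [Finite α] [Finite β] [Finite κ] (P : MvPolynomial (α × β ⊕ κ) F) (hP : P ≠ 0) :
    uniformProb {D : Matrix α β F | ∀ p : κ → F,
      eval (Sum.elim (fun x => D x.1 x.2) p) P = 0} ≤ (P.totalDegree : ℝ) / Nat.card F := by
  refine le_trans ?_ (uniformProb_eval_eq_zero_le P hP)
  have : Finite (Matrix α β F) := inferInstanceAs (Finite (α → β → F))
  rw [← uniformProb_preimage_fst (β := κ → F)]
  let e : Matrix α β F × (κ → F) ≃ (α × β ⊕ κ → F) :=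
    (((Equiv.curry α β F).symm : (α → β → F) ≃ _).prodCongr (Equiv.refl _)).trans
      (Equiv.sumArrowEquivProdArrow _ _ _).symm
  rw [← uniformProb_preimage_equiv e]
  apply uniformProb_mono
  rintro ⟨D, p⟩ h
  have h' := h p
  simp only [Set.mem_preimage, Set.mem_ofPred_eq]
  exact h'

/-! ### From recoverable requests to achievable costs. -/

/-- With the assignment `Z`, the workers can send `T` symbols each such that the answers of any
`Nr` of them determine the requested product `D * W`. -/
def Recoverable {F : Type} [Field F] {K N Kc : ℕ} (Z : Fin N → Finset (Fin K)) (Nr T L : ℕ)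
    (D : Matrix (Fin Kc) (Fin K) F) : Prop :=
  ∃ enc : Fin N → Matrix (Fin K) (Fin L) F → Fin T → F,
    (∀ n W W', (∀ k ∈ Z n, W k = W' k) → enc n W = enc n W') ∧
    ∀ A : Finset (Fin N), A.card = Nr → ∀ W W', (∀ n ∈ A, enc n W = enc n W') → D * W = D * W'

theorem exists_scheme_of_assignment (F : Type) [Field F] {K N Kc M : ℕ} (Nr T L : ℕ)
    (Z : Fin N → Finset (Fin K)) (hZ : ∀ n, (Z n).card ≤ M) :
    ∃ s : Scheme F K N Kc M L, (∀ n, s.len n = T) ∧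
      ∀ D, Recoverable Z Nr T L D → ∀ A : Finset (Fin N), A.card = Nr → ∀ W,
        s.output A D W = D * W := by
  classical
  let enc (D : Matrix (Fin Kc) (Fin K) F) : Fin N → Matrix (Fin K) (Fin L) F → Fin T → F :=
    -- Other requests get a dummy encoder; they only have to be rare.
    if h : Recoverable Z Nr T L D then h.choose else 0
  refine ⟨{ assign := fun n _ => Z n
            card_assign_le := fun n _ => hZ n
            len := fun _ => T
            encode := fun n D w => enc D n (fun k l => if hk : k ∈ Z n then w k hk l else 0)
            -- Any messages consistent with the answers serve, since recoverability gives them the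
            -- same product with `D`.
            decode := fun A D x =>
              if h : ∃ W, ∀ n (hn : n ∈ A), enc D n W = x n hn then D * h.choose else 0 },
          fun _ => rfl, ?_⟩
  intro D hD A hA W
  have henc : enc D = hD.choose := by simp only [enc, dif_pos hD]
  have hmask : ∀ n, enc D n (fun k l => if k ∈ Z n then W k l else 0) = enc D n W := by
    intro n
    rw [henc]
    refine hD.choose_spec.1 n _ _ fun k hk => ?_
    ext l; simp [hk]
  have hex : ∃ W', ∀ n (_ : n ∈ A), enc D n W' =
      enc D n (fun k l => if k ∈ Z n then W k l else 0) := ⟨W, fun n _ => (hmask n).symm⟩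
  simp only [Scheme.output, Scheme.answer, dite_eq_ite]
  rw [dif_pos hex]
  refine hD.choose_spec.2 A hA _ _ fun n hn => ?_
  rw [← henc, hex.choose_spec n hn, hmask]

/-- Integer coefficients make the degree bound uniform over all fields. The variables in `κ` are
free parameters of the code: a request can fail only if `P` vanishes for every choice of them. -/
theorem achievable_of_polynomial {K N Nr Kc M T L : ℕ} (hL : 0 < L) (Z : Fin N → Finset (Fin K))
    (hZ : ∀ n, (Z n).card ≤ M) {κ : Type} [Finite κ]
    (P : MvPolynomial (Fin Kc × Fin K ⊕ κ) ℤ)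
    (hP : ∀ (F : Type) [Field F], map (Int.castRingHom F) P ≠ 0) (Q₀ : ℕ)
    (h : ∀ (F : Type) [Field F] [Finite F], Q₀ ≤ Nat.card F →
      ∀ (D : Matrix (Fin Kc) (Fin K) F) (p : κ → F),
        eval (Sum.elim (fun x => D x.1 x.2) p) (map (Int.castRingHom F) P) ≠ 0 →
          Recoverable Z Nr T L D) :
    Achievable K N Nr Kc M ((Nr : ℝ) * T / L) := by
  refine ⟨L, hL, fun F _ _ => (exists_scheme_of_assignment F Nr T L Z hZ).choose, ?_, ?_⟩
  · intro F _ _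
    have hs := (exists_scheme_of_assignment F (Kc := Kc) Nr T L Z hZ).choose_spec
    refine Real.iSup_le (fun A => ?_) (by positivity)
    simp [hs.1, A.2]
  · intro δ hδ
    obtain ⟨Q₁, hQ₁⟩ := exists_nat_ge ((P.totalDegree : ℝ) / δ)
    refine ⟨max Q₀ Q₁, fun F _ _ hF => Real.iSup_le (fun A => ?_) hδ.le⟩
    have hs := (exists_scheme_of_assignment F (Kc := Kc) Nr T L Z hZ).choose_spec
    have hF₀ : Q₀ ≤ Nat.card F := le_trans (le_max_left _ _) hF
    have hF₁ : (Q₁ : ℝ) ≤ Nat.card F := by exact_mod_cast le_trans (le_max_right _ _) hF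
    have hF₂ : (0 : ℝ) < Nat.card F := by exact_mod_cast Nat.card_pos
    have : Finite (Matrix (Fin Kc) (Fin K) F) := inferInstanceAs (Finite (Fin Kc → Fin K → F))
    have : Finite (Matrix (Fin K) (Fin L) F) := inferInstanceAs (Finite (Fin K → Fin L → F))
    calc _ ≤ uniformProb {p : Matrix (Fin Kc) (Fin K) F × Matrix (Fin K) (Fin L) F |
          p.1 ∈ {D | ∀ p : κ → F, eval (Sum.elim (fun x => D x.1 x.2) p)
            (map (Int.castRingHom F) P) = 0}} := by
          refine uniformProb_mono ?_
          rintro ⟨D, W⟩ hDW p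
          by_contra hp
          exact hDW (hs.2 D (h F hF₀ D p hp) A.1 A.2 W)
      _ ≤ ((map (Int.castRingHom F) P).totalDegree : ℝ) / Nat.card F := by
          rw [uniformProb_preimage_fst]
          exact uniformProb_forall_eval_eq_zero_le _ (hP F)
      _ ≤ (P.totalDegree : ℝ) / Nat.card F := by
          gcongr
          exact Finset.sup_mono (support_map_subset _ _)
      _ ≤ δ := by
          rw [div_le_iff₀ hF₂]
          rw [div_le_iff₀ hδ] at hQ₁
          nlinarith

/-! ### The determinant testing whether column spans meet trivially. -/

section Determinant

variable {N t m : ℕ} {R S : Type} [CommRing R] [CommRing S]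

/-- The columns of `D` in the blocks listed by `miss`. -/
def blockColumns {ρ : Type} (D : Matrix ρ (Fin N × Fin m) R) (miss : Fin t → Fin N) :
    Matrix ρ (Fin t × Fin m) R :=
  D.submatrix id fun c => (miss c.1, c.2)

/-- The matrix of the linear system `D_α x_α + y = 0`, where `D_α` collects the columns of `D` in
the blocks `miss α`. -/
def jointMatrix (D : Matrix (Fin (t + 1) × Fin m) (Fin N × Fin m) R)
    (miss : Fin (t + 1) → Fin t → Fin N) :
    Matrix (Fin (t + 1) × (Fin (t + 1) × Fin m))
      ((Fin (t + 1) × (Fin t × Fin m)) ⊕ (Fin (t + 1) × Fin m)) R :=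
  Matrix.of fun x => Sum.elim (fun c => if x.1 = c.1 then blockColumns D (miss x.1) x.2 c.2 else 0)
    (fun ρ => if x.2 = ρ then 1 else 0)

theorem jointMatrix_mulVec (D : Matrix (Fin (t + 1) × Fin m) (Fin N × Fin m) R)
    (miss : Fin (t + 1) → Fin t → Fin N)
    (z : (Fin (t + 1) × (Fin t × Fin m)) ⊕ (Fin (t + 1) × Fin m) → R)
    (α : Fin (t + 1)) (ρ : Fin (t + 1) × Fin m) :
    (jointMatrix D miss).mulVec z (α, ρ) =
      (blockColumns D (miss α)).mulVec (fun c => z (Sum.inl (α, c))) ρ + z (Sum.inr ρ) := by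
  simp only [Matrix.mulVec, dotProduct, Fintype.sum_sum_type]
  congr 1
  · rw [Fintype.sum_prod_type, Finset.sum_eq_single α]
    · simp [jointMatrix]
    · intro β _ hβ
      simp [jointMatrix, hβ.symm]
    · simp
  · simp [jointMatrix]

/-- The row and the column index types of `jointMatrix` have the same cardinality. -/
def jointEquiv (t m : ℕ) : (Fin (t + 1) × (Fin (t + 1) × Fin m)) ≃
    ((Fin (t + 1) × (Fin t × Fin m)) ⊕ (Fin (t + 1) × Fin m)) :=
  Fintype.equivOfCardEq (by simp; ring)

/-- The determinant of `jointMatrix`. -/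
def jointDet (D : Matrix (Fin (t + 1) × Fin m) (Fin N × Fin m) R)
    (miss : Fin (t + 1) → Fin t → Fin N) : R :=
  ((jointMatrix D miss).submatrix id (jointEquiv t m)).det

theorem map_jointDet (f : R →+* S) (D : Matrix (Fin (t + 1) × Fin m) (Fin N × Fin m) R)
    (miss : Fin (t + 1) → Fin t → Fin N) :
    f (jointDet D miss) = jointDet (D.map f) miss := by
  unfold jointDet
  rw [RingHom.map_det]
  congr 1
  ext x y
  simp only [RingHom.mapMatrix_apply, Matrix.map_apply, Matrix.submatrix_apply, jointMatrix,
    Matrix.of_apply]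
  rcases jointEquiv t m y with c | ρ
  · simp only [Sum.elim_inl, apply_ite f, map_zero, blockColumns, Matrix.submatrix_apply,
      Matrix.map_apply]
  · simp only [Sum.elim_inr, apply_ite f, map_zero, map_one]

/-- The system has as many equations as unknowns. Solutions with `y = 0` are dependencies among the
columns of a block; a nonzero `y` is a vector common to all the spans. -/
theorem jointDet_ne_zero_iff [IsDomain R] (D : Matrix (Fin (t + 1) × Fin m) (Fin N × Fin m) R)
    (miss : Fin (t + 1) → Fin t → Fin N) :
    jointDet D miss ≠ 0 ↔ ∀ (x : Fin (t + 1) → Fin t × Fin m → R) (y : Fin (t + 1) × Fin m → R),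
      (∀ α, (blockColumns D (miss α)).mulVec (x α) + y = 0) → x = 0 ∧ y = 0 := by
  unfold jointDet
  rw [Ne, ← Matrix.exists_mulVec_eq_zero_iff]
  constructor
  · intro h x y hxy
    by_contra hne
    let z : (Fin (t + 1) × (Fin t × Fin m)) ⊕ (Fin (t + 1) × Fin m) → R :=
      Sum.elim (fun c => x c.1 c.2) y
    refine h ⟨z ∘ jointEquiv t m, fun h0 => hne ?_, ?_⟩
    · have hz : z = 0 := by
        funext c
        simpa using congrFun h0 ((jointEquiv t m).symm c)
      exact ⟨funext fun α => funext fun c => congrFun hz (Sum.inl (α, c)),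
        funext fun ρ => congrFun hz (Sum.inr ρ)⟩
    · rw [Matrix.submatrix_mulVec_equiv]
      funext ⟨α, ρ⟩
      simp only [Function.comp_def, Equiv.apply_symm_apply, id]
      rw [jointMatrix_mulVec]
      exact congrFun (hxy α) ρ
  · rintro h ⟨z, hz0, hz⟩
    rw [Matrix.submatrix_mulVec_equiv] at hz
    have := h (fun α c => z ((jointEquiv t m).symm (Sum.inl (α, c))))
      (fun ρ => z ((jointEquiv t m).symm (Sum.inr ρ))) fun α => by
        funext ρ
        have := congrFun hz (α, ρ)
        simp only [Function.comp_apply, id, Pi.zero_apply] at this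
        rw [jointMatrix_mulVec] at this
        exact this
    apply hz0
    funext w
    obtain ⟨c, rfl⟩ := (jointEquiv t m).symm.surjective w
    rcases c with ⟨α, c⟩ | ρ
    · exact congrFun (congrFun this.1 α) c
    · exact congrFun this.2 ρ

end Determinant

/-! ### The cyclic assignment and its generic nonvanishing. -/

/-- The cyclically `t` last predecessors of `n`. -/
def cyclicMissing {N t : ℕ} (n : Fin N) (i : Fin t) : Fin N :=
  ⟨(n + (N - t) + i) % N, Nat.mod_lt _ n.pos⟩

theorem cyclicMissing_injective {N t : ℕ} (h : t ≤ N) (n : Fin N) :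
    Function.Injective (cyclicMissing n : Fin t → Fin N) := by
  intro i j hij
  have h1 : (n + (N - t) + i : ℕ) ≡ n + (N - t) + j [MOD N] := congrArg Fin.val hij
  have h2 := Nat.ModEq.add_left_cancel' _ h1
  exact Fin.ext (Nat.ModEq.eq_of_lt_of_lt h2 (by omega) (by omega))

/-- For distinct `a β` there is a matching of the rows `β ≠ α` with the blocks missing from `a α`
under which each row is matched with a block not missing from it. -/
theorem exists_matching {N t : ℕ} (ht : t < N) (a : Fin (t + 1) ↪ Fin N) (α : Fin (t + 1)) :
    ∃ k : {β // β ≠ α} ≃ Fin t, ∀ β, ∀ i : Fin t,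
      cyclicMissing (a β.1) i ≠ cyclicMissing (a α) (k β) := by
  classical
  have hpos : ∀ n : Fin N, (n : ℕ) < N := fun n => n.2
  -- The cyclic distance from `a α` to `a β`.
  let p : Fin (t + 1) → ℕ := fun β => (a β + N - a α) % N
  have hp_lt : ∀ β, p β < N := fun β => Nat.mod_lt _ (a α).pos
  have hp_mod : ∀ β, (a α + p β : ℕ) ≡ a β [MOD N] := by
    intro β
    have h1 : (a α + p β : ℕ) ≡ a α + (a β + N - a α) [MOD N] :=
      Nat.ModEq.add_left _ (Nat.mod_modEq _ _)
    have h2 : (a α + (a β + N - a α) : ℕ) = a β + N := by have := hpos (a α); omega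
    rw [h2] at h1
    simpa [Nat.ModEq] using h1
  have hp_inj : Function.Injective p := by
    intro β γ hβγ
    have h1 : (a β : ℕ) ≡ a γ [MOD N] := (hp_mod β).symm.trans (hβγ ▸ hp_mod γ)
    exact a.injective (Fin.ext (Nat.ModEq.eq_of_lt_of_lt h1 (hpos _) (hpos _)))
  have hpα : p α = 0 := by simp [p]
  have hp_pos : ∀ β, β ≠ α → 0 < p β := by
    intro β hβ
    rcases Nat.eq_zero_or_pos (p β) with h | h
    · exact absurd (hp_inj (h.trans hpα.symm)) hβ
    · exact h
  -- Row `β` is matched with the missing block of `a α` indexed by its rank in cyclic distance.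
  -- Counted from the first missing block of `a α`, row `β` misses positions `p β` to `p β + t - 1`.
  -- The bounds `rank β < p β` and `p β + t ≤ rank β + N` keep this window off position `rank β`
  -- modulo `N`.
  let lower : Fin (t + 1) → Finset (Fin (t + 1)) := fun β =>
    Finset.univ.filter fun γ => γ ≠ α ∧ p γ < p β
  let rank : Fin (t + 1) → ℕ := fun β => (lower β).card
  have hrank_lt : ∀ β, β ≠ α → rank β < p β := by
    intro β hβ
    have : (lower β).card ≤ (Finset.Ico 1 (p β)).card := by
      refine Finset.card_le_card_of_injOn p (fun γ hγ => ?_) hp_inj.injOn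
      have hγ' := (Finset.mem_filter.1 hγ).2
      have := hp_pos γ hγ'.1
      simp only [Finset.coe_Ico, Set.mem_Ico]
      omega
    rw [Nat.card_Ico] at this
    have := hp_pos β hβ
    simp only [rank]; omega
  have hupper : ∀ β, β ≠ α → p β + t ≤ rank β + N := by
    intro β hβ
    let upper : Finset (Fin (t + 1)) := Finset.univ.filter fun γ => p β < p γ
    have h1 : upper.card ≤ (Finset.Ioo (p β) N).card := by
      refine Finset.card_le_card_of_injOn p (fun γ hγ => ?_) hp_inj.injOn
      have hγ' := (Finset.mem_filter.1 hγ).2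
      have := hp_lt γ
      simp only [Finset.coe_Ioo, Set.mem_Ioo]
      omega
    rw [Nat.card_Ioo] at h1
    have h2 : (Finset.univ : Finset (Fin (t + 1))) ⊆ (lower β ∪ upper) ∪ {α, β} := by
      intro γ _
      simp only [Finset.mem_union, Finset.mem_filter, Finset.mem_univ, true_and,
        Finset.mem_insert, Finset.mem_singleton, lower, upper]
      rcases lt_trichotomy (p γ) (p β) with h | h | h
      · tauto
      · exact Or.inr (Or.inr (hp_inj h))
      · tauto
    have h3 := Finset.card_le_card h2
    rw [Finset.card_univ, Fintype.card_fin] at h3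
    have h4 := Finset.card_union_le (lower β ∪ upper) {α, β}
    have h5 := Finset.card_union_le (lower β) upper
    have h6 : ({α, β} : Finset (Fin (t + 1))).card ≤ 2 := Finset.card_le_two
    have h7 := hp_lt β
    simp only [rank]
    omega
  have hrank_t : ∀ β, β ≠ α → rank β < t := by
    intro β hβ
    have : lower β ⊆ (Finset.univ.erase α).erase β := by
      intro γ hγ
      have hγ' := (Finset.mem_filter.1 hγ).2
      simp only [Finset.mem_erase, Finset.mem_univ, and_true]
      exact ⟨fun h => by rw [h] at hγ'; exact lt_irrefl _ hγ'.2, hγ'.1⟩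
    have h1 := Finset.card_le_card this
    rw [Finset.card_erase_of_mem (by simpa using hβ), Finset.card_erase_of_mem (Finset.mem_univ _),
      Finset.card_univ, Fintype.card_fin] at h1
    have : 0 < t := by
      rcases Nat.eq_zero_or_pos t with h | h
      · subst h
        exact absurd (Fin.ext (by omega)) hβ
      · exact h
    simp only [rank]; omega
  have hrank_mono : ∀ β γ, β ≠ α → p β < p γ → rank β < rank γ := by
    intro β γ hβ h
    apply Finset.card_lt_card
    refine Finset.ssubset_iff_of_subset (fun δ hδ => ?_) |>.2 ⟨β, ?_, ?_⟩
    · have := (Finset.mem_filter.1 hδ).2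
      simp only [lower, Finset.mem_filter, Finset.mem_univ, true_and]
      exact ⟨this.1, this.2.trans h⟩
    · simp [lower, hβ, h]
    · simp [lower]
  let k : {β // β ≠ α} → Fin t := fun β => ⟨rank β.1, hrank_t β.1 β.2⟩
  have hk : Function.Injective k := by
    intro β γ hβγ
    have h : rank β.1 = rank γ.1 := congrArg Fin.val hβγ
    rcases lt_trichotomy (p β.1) (p γ.1) with h' | h' | h'
    · exact absurd h (hrank_mono _ _ β.2 h').ne
    · exact Subtype.ext (hp_inj h')
    · exact absurd h (hrank_mono _ _ γ.2 h').ne'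
  have hkb : Function.Bijective k := by
    rw [Fintype.bijective_iff_injective_and_card]
    refine ⟨hk, ?_⟩
    simp [Fintype.card_subtype_compl]
  refine ⟨Equiv.ofBijective k hkb, fun β i h => ?_⟩
  have h1 : (a β.1 + (N - t) + i : ℕ) ≡ a α + (N - t) + rank β.1 [MOD N] := congrArg Fin.val h
  have h2 : (a α + p β.1 + (N - t) + i : ℕ) ≡ a β.1 + (N - t) + i [MOD N] :=
    ((hp_mod β.1).add_right _).add_right _
  have h3 := h2.trans h1
  have h4 : (a α + (N - t) + (p β.1 + i) : ℕ) ≡ a α + (N - t) + rank β.1 [MOD N] := by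
    have : (a α + (N - t) + (p β.1 + i) : ℕ) = a α + p β.1 + (N - t) + i := by ring
    rw [this]; exact h3
  have h5 := Nat.ModEq.add_left_cancel' _ h4
  have h6 := hrank_lt _ β.2
  have h7 := hupper _ β.2
  have h8 := hp_lt β.1
  have h9 := (Nat.modEq_iff_dvd' (by omega : rank β.1 ≤ p β.1 + i)).1 h5.symm
  have h10 := Nat.le_of_dvd (by omega) h9
  have := i.2
  omega

/-- A matrix with indeterminate entries in the blocks not missing from the row, and zeros
elsewhere. -/
def patternMatrix {N t : ℕ} (F : Type) [Field F] (miss : Fin (t + 1) → Fin t → Fin N) :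
    Matrix (Fin (t + 1)) (Fin N) (MvPolynomial (Fin (t + 1) × Fin N) F) :=
  open Classical in Matrix.of fun β j => if ∃ i, miss β i = j then 0 else X (β, j)

theorem jointDet_pattern_ne_zero {N t : ℕ} (m : ℕ) (F : Type) [Field F] (ht : t < N)
    (a : Fin (t + 1) ↪ Fin N) :
    jointDet (m := m) (Matrix.of fun ρ c => if ρ.2 = c.2 then
      patternMatrix F (fun α => cyclicMissing (a α)) ρ.1 c.1 else 0)
      (fun α => cyclicMissing (a α)) ≠ 0 := by
  classical
  rw [jointDet_ne_zero_iff]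
  intro x y hxy
  have hrow : ∀ α β u, ∑ i, patternMatrix F (fun α => cyclicMissing (a α)) β
      (cyclicMissing (a α) i) * x α (i, u) + y (β, u) = 0 := by
    intro α β u
    have := congrFun (hxy α) (β, u)
    simpa only [Pi.add_apply, Matrix.mulVec, dotProduct, blockColumns, Fintype.sum_prod_type,
      Matrix.submatrix_apply, Matrix.of_apply, id, ite_mul, zero_mul, Finset.sum_ite_eq,
      Finset.mem_univ, if_true, Pi.zero_apply] using this
  -- Row `α` of the pattern vanishes on the blocks missing from `a α`, so only `y` survives in that
  -- row of equation `α`.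
  have hy : y = 0 := by
    funext ⟨α, u⟩
    have := hrow α α u
    simpa [patternMatrix] using this
  refine ⟨?_, hy⟩
  funext α ⟨i, u⟩
  obtain ⟨k, hk⟩ := exists_matching ht a α
  let Q : Matrix {β // β ≠ α} {β // β ≠ α} (MvPolynomial (Fin (t + 1) × Fin N) F) :=
    Matrix.of fun β γ => patternMatrix F (fun α => cyclicMissing (a α)) β.1
      (cyclicMissing (a α) (k γ))
  have hQ : Q.det ≠ 0 := by
    intro h0
    -- Setting the matched indeterminates to one and the others to zero turns `Q` into the identity.
    let φ : MvPolynomial (Fin (t + 1) × Fin N) F →+* F := eval fun z =>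
      if h : z.1 ≠ α then (if z.2 = cyclicMissing (a α) (k ⟨z.1, h⟩) then 1 else 0) else 0
    have h1 := congrArg φ h0
    rw [RingHom.map_det] at h1
    have : φ.mapMatrix Q = 1 := by
      ext β γ
      simp only [RingHom.mapMatrix_apply, Matrix.map_apply, Q, Matrix.of_apply, patternMatrix,
        Matrix.one_apply]
      by_cases hβγ : β = γ
      · subst hβγ
        rw [if_neg (fun ⟨i, hi⟩ => hk β i hi)]
        simp [φ, β.2]
      · have hne : cyclicMissing (a α) (k γ) ≠ cyclicMissing (a α) (k β) := by
          intro h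
          exact hβγ (k.injective (cyclicMissing_injective ht.le _ h)).symm
        split_ifs
        · simp
        · simp [φ, β.2, hne]
    rw [this] at h1
    simp at h1
  have hv : Q.mulVec (fun γ => x α (k γ, u)) = 0 := by
    funext β
    have := hrow α β.1 u
    rw [hy, Pi.zero_apply, add_zero] at this
    simp only [Matrix.mulVec, dotProduct, Q, Matrix.of_apply, Pi.zero_apply]
    rw [← this]
    exact Equiv.sum_comp k fun i => patternMatrix F (fun α => cyclicMissing (a α)) β.1
      (cyclicMissing (a α) i) * x α (i, u)
  have := Matrix.eq_zero_of_mulVec_eq_zero hQ hv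
  simpa using congrFun this (k.symm i)

/-- The polynomial in the entries of a matrix whose nonvanishing makes the matrix suitable for the
cyclic assignment. -/
def cyclicPolynomial (N t m : ℕ) :
    MvPolynomial ((Fin (t + 1) × Fin m) × (Fin N × Fin m)) ℤ :=
  ∏ a : Fin (t + 1) ↪ Fin N, jointDet (Matrix.of fun ρ c => X (ρ, c))
    (fun α => cyclicMissing (a α))

theorem eval₂Hom_cyclicPolynomial {N t m : ℕ} {R : Type} [CommRing R]
    (D : Matrix (Fin (t + 1) × Fin m) (Fin N × Fin m) R) :
    eval₂Hom (Int.castRingHom R) (fun x => D x.1 x.2) (cyclicPolynomial N t m) =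
      ∏ a : Fin (t + 1) ↪ Fin N, jointDet D (fun α => cyclicMissing (a α)) := by
  unfold cyclicPolynomial
  rw [map_prod]
  refine Finset.prod_congr rfl fun a _ => ?_
  rw [map_jointDet]
  congr 1
  ext ρ c
  simp

/-- Polynomials over `F` form a domain, so each factor may be tested at its own specialisation: the
pattern matrix with each entry expanded to a scalar `m × m` block. -/
theorem map_cyclicPolynomial_ne_zero {N t m : ℕ} (ht : t < N) (F : Type) [Field F] :
    map (Int.castRingHom F) (cyclicPolynomial N t m) ≠ 0 := by
  unfold cyclicPolynomial
  rw [map_prod, Finset.prod_ne_zero_iff]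
  intro a _ h0
  let D : Matrix (Fin (t + 1) × Fin m) (Fin N × Fin m) (MvPolynomial (Fin (t + 1) × Fin N) F) :=
    Matrix.of fun ρ c => if ρ.2 = c.2 then
      patternMatrix F (fun α => cyclicMissing (a α)) ρ.1 c.1 else 0
  have h1 := congrArg
    (aeval (R := F) fun x : (Fin (t + 1) × Fin m) × (Fin N × Fin m) => D x.1 x.2) h0
  rw [map_jointDet, map_zero] at h1
  have h2 := map_jointDet (aeval (R := F) fun x : (Fin (t + 1) × Fin m) × (Fin N × Fin m) =>
    D x.1 x.2).toRingHom ((Matrix.of fun ρ c => X (ρ, c)).map (map (Int.castRingHom F)))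
    (fun α => cyclicMissing (t := t) (a α))
  refine jointDet_pattern_ne_zero m F ht a ?_
  refine Eq.trans (Eq.trans ?_ h2.symm) h1
  congr 1
  refine Matrix.ext fun ρ c => ?_
  simp [D]

/-- For a matrix `D` off the zero set of `cyclicPolynomial`, worker `n` can compute from the blocks
assigned to it a linear image `S n (D w)` of `D w`, of dimension `m`, such that the images of any
`t + 1` workers determine `D w`. -/
theorem exists_linearMap_of_cyclicPolynomial_ne_zero {N t m : ℕ} (ht : t < N) {F : Type} [Field F]
    (D : Matrix (Fin (t + 1) × Fin m) (Fin N × Fin m) F)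
    (hD : eval (fun x => D x.1 x.2) (map (Int.castRingHom F) (cyclicPolynomial N t m)) ≠ 0) :
    ∃ S : Fin N → (Fin (t + 1) × Fin m → F) →ₗ[F] (Fin m → F),
      (∀ n w, (∀ j, (∀ i : Fin t, cyclicMissing n i ≠ j) → ∀ u, w (j, u) = 0) →
        S n (D.mulVec w) = 0) ∧
      ∀ A : Finset (Fin N), A.card = t + 1 → ∀ v, (∀ n ∈ A, S n v = 0) → v = 0 := by
  classical
  have hdet : ∀ a : Fin (t + 1) ↪ Fin N, jointDet D (fun α => cyclicMissing (a α)) ≠ 0 := by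
    rw [eval_map, ← coe_eval₂Hom, eval₂Hom_cyclicPolynomial, Finset.prod_ne_zero_iff] at hD
    exact fun a => hD a (Finset.mem_univ _)
  let B : Fin N → (Fin t × Fin m → F) →ₗ[F] (Fin (t + 1) × Fin m → F) := fun n =>
    (blockColumns D (cyclicMissing n)).mulVecLin
  have hB : ∀ n, Function.Injective (B n) := by
    intro n
    rw [← LinearMap.ker_eq_bot, LinearMap.ker_eq_bot']
    intro x hx
    -- Any selection of workers containing `n` would do; the swap puts `n` at place `0`.
    let a : Fin (t + 1) ↪ Fin N := (Fin.castLEEmb ht).trans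
      (Equiv.swap (Fin.castLE ht 0) n).toEmbedding
    have ha : a 0 = n := by simp [a]
    have := ((jointDet_ne_zero_iff _ _).1 (hdet a)) (Pi.single 0 x) 0 fun α => by
      rw [add_zero]
      by_cases hα : α = 0
      · subst hα
        rw [ha, Pi.single_eq_same]
        exact hx
      · rw [Pi.single_eq_of_ne hα, Matrix.mulVec_zero]
    simpa using congrFun this.1 0
  have hrank : ∀ n, Module.finrank F ((Fin (t + 1) × Fin m → F) ⧸ LinearMap.range (B n)) =
      Module.finrank F (Fin m → F) := by
    intro n
    have h1 := Submodule.finrank_quotient_add_finrank (LinearMap.range (B n))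
    rw [LinearMap.finrank_range_of_inj (hB n)] at h1
    simp only [Module.finrank_fintype_fun_eq_card, Fintype.card_prod, Fintype.card_fin] at h1 ⊢
    have h2 : (t + 1) * m = t * m + m := by ring
    omega
  -- Dividing by the span of the missing columns removes what worker `n` cannot see and leaves `m`
  -- coordinates.
  let S : Fin N → (Fin (t + 1) × Fin m → F) →ₗ[F] (Fin m → F) := fun n =>
    (LinearEquiv.ofFinrankEq _ _ (hrank n)).toLinearMap ∘ₗ (LinearMap.range (B n)).mkQ
  have hS : ∀ n v, S n v = 0 ↔ v ∈ LinearMap.range (B n) := by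
    intro n v
    simp [S]
  refine ⟨S, fun n w hw => (hS _ _).2 ⟨fun c => w (cyclicMissing n c.1, c.2), ?_⟩,
    fun A hA v hv => ?_⟩
  · funext ρ
    have hinj : Function.Injective fun c : Fin t × Fin m => (cyclicMissing n c.1, c.2) := by
      rintro ⟨i, u⟩ ⟨i', u'⟩ h
      simp only [Prod.mk.injEq] at h ⊢
      exact ⟨cyclicMissing_injective ht.le n h.1, h.2⟩
    simp only [B, Matrix.mulVecLin_apply, Matrix.mulVec, dotProduct, blockColumns,
      Matrix.submatrix_apply, id]
    refine Fintype.sum_of_injective _ hinj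
      (fun c => D ρ (cyclicMissing n c.1, c.2) * w (cyclicMissing n c.1, c.2))
      (fun c => D ρ c * w c) ?_ ?_
    · rintro ⟨j, u⟩ hc
      rw [hw j (fun i hi => hc ⟨(i, u), by simp [hi]⟩), mul_zero]
    · intro c
      rfl
  · let a : Fin (t + 1) ↪ Fin N := (A.orderEmbOfFin hA).toEmbedding
    have hv' : ∀ α, ∃ x, B (a α) x = v := fun α =>
      (hS _ _).1 (hv _ (A.orderEmbOfFin_mem hA α))
    choose x hx using hv'
    -- A vector killed by all these maps lies in every span, so its negative solves the joint
    -- system.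
    have := ((jointDet_ne_zero_iff _ _).1 (hdet a)) x (-v) fun α => by
      rw [← hx α]
      exact add_neg_cancel _
    exact neg_eq_zero.1 this.2

/-- The cyclic assignment of `N` blocks of `m` datasets. -/
def cyclicAssignment (N t m : ℕ) (n : Fin N) : Finset (Fin (N * m)) :=
  open Classical in Finset.univ.filter fun k =>
    ∀ i : Fin t, cyclicMissing n i ≠ (finProdFinEquiv.symm k).1

theorem mem_cyclicAssignment {N t m : ℕ} (n j : Fin N) (u : Fin m) :
    finProdFinEquiv (j, u) ∈ cyclicAssignment N t m n ↔ ∀ i : Fin t, cyclicMissing n i ≠ j := by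
  simp only [cyclicAssignment, Finset.mem_filter, Finset.mem_univ, true_and,
    Equiv.symm_apply_apply]

theorem card_cyclicAssignment {N t m : ℕ} (ht : t ≤ N) (n : Fin N) :
    (cyclicAssignment N t m n).card = (N - t) * m := by
  classical
  have h : cyclicAssignment N t m n = ((Finset.univ \ Finset.univ.image
      (cyclicMissing n : Fin t → Fin N)) ×ˢ (Finset.univ : Finset (Fin m))).map
        finProdFinEquiv.toEmbedding := by
    ext k
    obtain ⟨⟨j, u⟩, rfl⟩ := finProdFinEquiv.surjective k
    rw [mem_cyclicAssignment]
    simp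
  rw [h, Finset.card_map, Finset.card_product, Finset.card_sdiff_of_subset (Finset.subset_univ _),
    Finset.card_image_of_injective _ (cyclicMissing_injective ht n)]
  simp

theorem map_rename_ne_zero {F : Type} [Field F] {ι κ : Type} (g : ι → κ)
    (hg : Function.Injective g) {P : MvPolynomial ι ℤ} (hP : map (Int.castRingHom F) P ≠ 0) :
    map (Int.castRingHom F) (rename g P) ≠ 0 := by
  rwa [map_rename, Ne, map_eq_zero_iff _ (rename_injective g hg)]

theorem exists_linearMap_cyclicAssignment {N t m : ℕ} (ht : t < N) {F : Type} [Field F]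
    (D : Matrix (Fin (t + 1) × Fin m) (Fin N × Fin m) F)
    (hD : eval (fun x => D x.1 x.2) (map (Int.castRingHom F) (cyclicPolynomial N t m)) ≠ 0) :
    ∃ S : Fin N → (Fin (N * m) → F) →ₗ[F] (Fin m → F),
      (∀ n w, (∀ k ∈ cyclicAssignment N t m n, w k = 0) → S n w = 0) ∧
      ∀ A : Finset (Fin N), A.card = t + 1 → ∀ w, (∀ n ∈ A, S n w = 0) →
        ∀ ρ, ∑ c, D ρ c * w (finProdFinEquiv c) = 0 := by
  obtain ⟨S, hS1, hS2⟩ := exists_linearMap_of_cyclicPolynomial_ne_zero ht D hD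
  refine ⟨fun n => S n ∘ₗ D.mulVecLin ∘ₗ LinearMap.funLeft F F finProdFinEquiv,
    fun n w hw => hS1 n _ fun j hj u => hw _ ((mem_cyclicAssignment n j u).2 hj),
    fun A hA w hw ρ => ?_⟩
  exact congrFun (hS2 A hA _ fun n hn => hw n hn) ρ

/-! ### Achievability of the three costs. -/

/-- Requests of at most `t + 1` rows are padded to `t + 1` rows. -/
theorem achievable_of_le {N t m Kc M : ℕ} (ht : t < N) (hm : m = 1) (hKc : Kc ≤ t + 1)
    (hM : (N - t) * m ≤ M) : Achievable (N * m) N (t + 1) Kc M ((t + 1 : ℕ) : ℝ) := by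
  classical
  obtain ⟨g, hg, hg_lt⟩ : ∃ g : (Fin (t + 1) × Fin m) × (Fin N × Fin m) →
      Fin Kc × Fin (N * m) ⊕ (Fin (t + 1) × Fin m) × (Fin N × Fin m), Function.Injective g ∧
      ∀ (ρ : Fin (t + 1) × Fin m) (c : Fin N × Fin m) (h : (ρ.1 : ℕ) < Kc),
        g (ρ, c) = Sum.inl (⟨ρ.1, h⟩, finProdFinEquiv c) := by
    refine ⟨fun x => if h : (x.1.1 : ℕ) < Kc then Sum.inl (⟨x.1.1, h⟩, finProdFinEquiv x.2)
      else Sum.inr x, ?_, fun ρ c h => dif_pos h⟩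
    rintro ⟨⟨i, u⟩, c⟩ ⟨⟨i', u'⟩, c'⟩ h
    -- On request rows `g` forgets `u`, so injectivity rests on `m = 1`.
    have hu : u = u' := Fin.ext (by omega)
    dsimp only at h
    split_ifs at h with h1 h2 h2
    · have h3 := Prod.mk.inj (Sum.inl.inj h)
      have h4 : (i : ℕ) = i' := Fin.mk.inj h3.1
      have h5 : c = c' := finProdFinEquiv.injective h3.2
      rw [hu, Fin.ext h4, h5]
    · exact Sum.inr.inj h
  have key := achievable_of_polynomial (T := m) (L := 1) (Nr := t + 1) (M := M) one_pos
    (cyclicAssignment N t m)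
    (fun n => by rw [card_cyclicAssignment ht.le]; exact hM)
    (rename g (cyclicPolynomial N t m))
    (fun F _ => map_rename_ne_zero g hg (map_cyclicPolynomial_ne_zero ht F)) 0 ?_
  · have hcost : ((t + 1 : ℕ) : ℝ) * (m : ℝ) / ((1 : ℕ) : ℝ) = ((t + 1 : ℕ) : ℝ) := by
      rw [hm]; simp
    rwa [hcost] at key
  intro F _ _ _ D p hp
  rw [map_rename, eval_rename] at hp
  let Dp : Matrix (Fin (t + 1) × Fin m) (Fin N × Fin m) F :=
    Matrix.of fun ρ c => Sum.elim (fun x => D x.1 x.2) p (g (ρ, c))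
  obtain ⟨S, hS1, hS2⟩ := exists_linearMap_cyclicAssignment ht Dp hp
  refine ⟨fun n W => S n (fun k => W k 0), fun n W W' h => ?_, fun A hA W W' h => ?_⟩
  · rw [← sub_eq_zero, ← map_sub]
    refine hS1 n _ fun k hk => ?_
    rw [Pi.sub_apply, h k hk, sub_self]
  · have h0 := hS2 A hA ((fun k => W k 0) - fun k => W' k 0) fun n hn => by
      rw [map_sub, sub_eq_zero]; exact h n hn
    ext i l
    have h2 : ∑ c, D i (finProdFinEquiv c) * (W (finProdFinEquiv c) 0 - W' (finProdFinEquiv c) 0)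
        = 0 := by
      rw [← h0 (⟨i, by omega⟩, ⟨0, by omega⟩)]
      refine Finset.sum_congr rfl fun c _ => ?_
      have h3 : Dp (⟨i, by omega⟩, ⟨0, by omega⟩) c = D i (finProdFinEquiv c) := by
        simp only [Dp, Matrix.of_apply]
        rw [hg_lt (⟨i, by omega⟩, ⟨0, by omega⟩) c i.2, Sum.elim_inl]
      rw [h3, Pi.sub_apply]
    rw [finProdFinEquiv.sum_comp fun k => D i k * (W k 0 - W' k 0)] at h2
    rw [Subsingleton.elim l 0]
    simp only [mul_sub, Finset.sum_sub_distrib, sub_eq_zero] at h2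
    exact h2

/-- Each row of the request is treated as a sum of `N` blocks and recovered separately. -/
theorem achievable_mul {N t m Kc M : ℕ} (ht : t < N) (hM : (N - t) * m ≤ M) :
    Achievable (N * m) N (t + 1) Kc M (((t + 1 : ℕ) : ℝ) * Kc) := by
  classical
  let κ : Type := (Fin (t + 1) × Fin 1) × (Fin N × Fin 1)
  -- The extra factor keeps row `0` of the auxiliary matrix free of zeros, so that `y` below can
  -- divide by its entries.
  let Q : MvPolynomial κ ℤ := cyclicPolynomial N t 1 * ∏ j : Fin N, X ((0, 0), (j, 0))
  have key := achievable_of_polynomial (T := Kc) (L := 1) (Nr := t + 1) (M := M) one_pos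
    (cyclicAssignment N t m)
    (fun n => by rw [card_cyclicAssignment ht.le]; exact hM)
    (rename (Sum.inr : κ → Fin Kc × Fin (N * m) ⊕ κ) Q)
    (fun F _ => map_rename_ne_zero _ Sum.inr_injective ?_) 0 ?_
  · simpa using key
  · simp only [Q, map_mul, map_prod]
    refine mul_ne_zero (map_cyclicPolynomial_ne_zero ht F) ?_
    simp [Finset.prod_ne_zero_iff]
  intro F _ _ _ D p hp
  rw [map_rename, eval_rename, Sum.elim_comp_inr] at hp
  simp only [Q, map_mul, map_prod, map_X, eval_X] at hp
  have hp1 := left_ne_zero_of_mul hp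
  have hp2 : ∀ j, p ((0, 0), (j, 0)) ≠ 0 := fun j =>
    Finset.prod_ne_zero_iff.1 (right_ne_zero_of_mul hp) j (Finset.mem_univ j)
  let Dp : Matrix (Fin (t + 1) × Fin 1) (Fin N × Fin 1) F := Matrix.of fun ρ c => p (ρ, c)
  obtain ⟨S, hS1, hS2⟩ := exists_linearMap_of_cyclicPolynomial_ne_zero ht Dp hp1
  -- The scaling makes row `0` of `Dp` send `y W i` to the requested entry of row `i`.
  let y : Matrix (Fin (N * m)) (Fin 1) F → Fin Kc → Fin N × Fin 1 → F := fun W i c =>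
    (p ((0, 0), (c.1, 0)))⁻¹ * ∑ u, D i (finProdFinEquiv (c.1, u)) * W (finProdFinEquiv (c.1, u)) 0
  refine ⟨fun n W i => S n (Dp.mulVec (y W i)) 0, fun n W W' h => ?_,
    fun A hA W W' h => ?_⟩
  · funext i
    refine congrFun ?_ 0
    rw [← sub_eq_zero, ← map_sub, ← Matrix.mulVec_sub]
    refine hS1 n _ fun j hj u => ?_
    simp only [Pi.sub_apply, sub_eq_zero, y]
    congr 1
    refine Finset.sum_congr rfl fun u _ => ?_
    rw [h _ ((mem_cyclicAssignment n j u).2 hj)]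
  · ext i l
    have h1 := hS2 A hA (Dp.mulVec (y W i - y W' i)) fun n hn => by
      rw [Matrix.mulVec_sub, map_sub, sub_eq_zero]
      funext u
      rw [Subsingleton.elim u 0]
      exact congrFun (h n hn) i
    have h2 := congrFun h1 (0, 0)
    have hy : ∀ W, ∑ c, p ((0, 0), c) * y W i c = ∑ k, D i k * W k 0 := by
      intro W
      rw [← finProdFinEquiv.sum_comp, Fintype.sum_prod_type, Fintype.sum_prod_type]
      refine Finset.sum_congr rfl fun j _ => ?_
      simp [y, hp2 j]
    rw [Subsingleton.elim l 0]
    simp only [Dp, Matrix.of_apply, Matrix.mulVec, dotProduct, Pi.sub_apply, mul_sub,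
      Finset.sum_sub_distrib, hy,
      Pi.zero_apply, sub_eq_zero] at h2
    exact h2

/-- Each message is encoded by a Vandermonde code into `Kc` symbols, one for each cyclic window of
`(t + 1) * m` rows of the request. -/
theorem achievable_self {N t m Kc M : ℕ} (ht : t < N) (hm : 0 < m) (hKc : (t + 1) * m ≤ Kc)
    (hM : (N - t) * m ≤ M) :
    Achievable (N * m) N (t + 1) Kc M (Kc : ℝ) := by
  classical
  have hL : 0 < (t + 1) * m := by positivity
  have : NeZero Kc := ⟨by omega⟩
  let e : Fin Kc → Fin (t + 1) × Fin m → Fin Kc := fun τ ρ =>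
    τ + Fin.castLE hKc (finProdFinEquiv ρ)
  have he : ∀ τ, Function.Injective (e τ) := fun τ ρ ρ' h =>
    finProdFinEquiv.injective (Fin.castLE_injective hKc (add_left_cancel h))
  let g : Fin Kc → (Fin (t + 1) × Fin m) × (Fin N × Fin m) → Fin Kc × Fin (N * m) ⊕ Empty :=
    fun τ x => Sum.inl (e τ x.1, finProdFinEquiv x.2)
  have hg : ∀ τ, Function.Injective (g τ) := by
    rintro τ ⟨ρ, c⟩ ⟨ρ', c'⟩ h
    have h3 := Prod.mk.inj (Sum.inl.inj h)
    exact Prod.ext (he τ h3.1) (finProdFinEquiv.injective h3.2)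
  have key := achievable_of_polynomial (T := Kc * m) (Nr := t + 1) (M := M) hL
    (cyclicAssignment N t m)
    (fun n => by rw [card_cyclicAssignment ht.le]; exact hM)
    -- The threshold `Kc` on the field order provides one evaluation point per window.
    (∏ τ, rename (g τ) (cyclicPolynomial N t m)) (fun F _ => ?_) Kc ?_
  · have hcost : ((t + 1 : ℕ) : ℝ) * ((Kc * m : ℕ) : ℝ) / (((t + 1) * m : ℕ) : ℝ) = Kc := by
      have : (m : ℝ) ≠ 0 := by exact_mod_cast hm.ne'
      push_cast
      field_simp
    rwa [hcost] at key
  · rw [map_prod, Finset.prod_ne_zero_iff]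
    exact fun τ _ => map_rename_ne_zero _ (hg τ) (map_cyclicPolynomial_ne_zero ht F)
  intro F _ _ hF D p hp
  rw [map_prod, map_prod, Finset.prod_ne_zero_iff] at hp
  have hS : ∀ τ, ∃ S : Fin N → (Fin (N * m) → F) →ₗ[F] (Fin m → F),
      (∀ n w, (∀ k ∈ cyclicAssignment N t m n, w k = 0) → S n w = 0) ∧
      ∀ A : Finset (Fin N), A.card = t + 1 → ∀ w, (∀ n ∈ A, S n w = 0) →
        ∀ ρ, ∑ k, D (e τ ρ) k * w k = 0 := by
    intro τ
    have hτ := hp τ (Finset.mem_univ _)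
    rw [map_rename, eval_rename] at hτ
    obtain ⟨S, hS1, hS2⟩ := exists_linearMap_cyclicAssignment ht
      (fun ρ c => D (e τ ρ) (finProdFinEquiv c)) hτ
    refine ⟨S, hS1, fun A hA w hw ρ => ?_⟩
    rw [← finProdFinEquiv.sum_comp]
    exact hS2 A hA w hw ρ
  choose S hS1 hS2 using hS
  have := Fintype.ofFinite F
  obtain ⟨α⟩ : Nonempty (Fin Kc ↪ F) := by
    apply Function.Embedding.nonempty_of_card_le
    rwa [Fintype.card_fin, ← Nat.card_eq_fintype_card]
  let w : Fin Kc → Matrix (Fin (N * m)) (Fin ((t + 1) * m)) F → Fin (N * m) → F := fun τ W k =>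
    ∑ l : Fin ((t + 1) * m), α τ ^ (l : ℕ) * W k l
  refine ⟨fun n W x => S (finProdFinEquiv.symm x).1 n (w (finProdFinEquiv.symm x).1 W)
    (finProdFinEquiv.symm x).2, fun n W W' h => ?_, fun A hA W W' h => ?_⟩
  · funext x
    refine congrFun ?_ _
    rw [← sub_eq_zero, ← map_sub]
    refine hS1 _ n _ fun k hk => ?_
    simp [w, h k hk]
  · have h1 : ∀ τ ρ, ∑ k, D (e τ ρ) k * (w τ W - w τ W') k = 0 := fun τ ρ =>
      hS2 τ A hA _ (fun n hn => by
        rw [map_sub, sub_eq_zero]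
        funext u
        simpa using congrFun (h n hn) (finProdFinEquiv (τ, u))) ρ
    have h2 : ∀ i, (fun l => (D * W) i l - (D * W') i l) = 0 := by
      intro i
      -- These are the `(t + 1) * m` windows containing row `i`. They evaluate, at as many distinct
      -- points, the polynomial whose coefficients are the differences in row `i`; its degree is
      -- less than `(t + 1) * m`, so it vanishes.
      let τ : Fin ((t + 1) * m) → Fin Kc := fun x => i - Fin.castLE hKc x
      have hτ : Function.Injective τ := fun x x' hx =>
        Fin.castLE_injective hKc (sub_right_injective hx)
      refine Matrix.eq_zero_of_forall_index_sum_pow_mul_eq_zero (α.injective.comp hτ) fun x => ?_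
      have h3 := h1 (τ x) (finProdFinEquiv.symm x)
      have h4 : e (τ x) (finProdFinEquiv.symm x) = i := by
        simp only [e, τ, Equiv.apply_symm_apply, sub_add_cancel]
      rw [h4] at h3
      rw [← h3]
      simp only [Matrix.mul_apply, Pi.sub_apply, w, ← Finset.sum_sub_distrib, Finset.mul_sum,
        Function.comp_apply]
      rw [Finset.sum_comm]
      refine Finset.sum_congr rfl fun k _ => Finset.sum_congr rfl fun l _ => ?_
      ring
    ext i l
    exact sub_eq_zero.1 (congrFun (h2 i) l)

/-! ### Generic requests and the choice of one with small error. -/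

/-- The product of all entries and of all maximal minors of a generic matrix. -/
def genericPolynomial (Kc K : ℕ) : MvPolynomial (Fin Kc × Fin K ⊕ Empty) ℤ :=
  (∏ x, X (Sum.inl x)) * ∏ e : Fin Kc ↪ Fin K,
    (Matrix.of fun i j => (X (Sum.inl (i, e j)) : MvPolynomial (Fin Kc × Fin K ⊕ Empty) ℤ)).det

theorem map_genericPolynomial_ne_zero (Kc K : ℕ) (F : Type) [Field F] :
    map (Int.castRingHom F) (genericPolynomial Kc K) ≠ 0 := by
  classical
  simp only [genericPolynomial, map_mul, map_prod, map_X]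
  refine mul_ne_zero (Finset.prod_ne_zero_iff.2 fun x _ => X_ne_zero _)
    (Finset.prod_ne_zero_iff.2 fun e _ h0 => ?_)
  let φ : MvPolynomial (Fin Kc × Fin K ⊕ Empty) F →+* F :=
    eval (Sum.elim (fun x => if x.2 = e x.1 then 1 else 0) Empty.elim)
  have h1 := congrArg φ h0
  rw [RingHom.map_det, RingHom.map_det, map_zero] at h1
  have h2 : φ.mapMatrix ((map (Int.castRingHom F)).mapMatrix (Matrix.of fun i j =>
      (X (Sum.inl (i, e j)) : MvPolynomial (Fin Kc × Fin K ⊕ Empty) ℤ))) = 1 := by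
    refine Matrix.ext fun i j => ?_
    simp [φ, Matrix.one_apply, eq_comm]
  rw [h2, Matrix.det_one] at h1
  exact one_ne_zero h1

/-- All entries and all maximal minors of the matrix are nonzero. -/
def IsGeneric {F : Type} [Field F] {Kc K : ℕ} (D : Matrix (Fin Kc) (Fin K) F) : Prop :=
  (∀ i k, D i k ≠ 0) ∧ ∀ e : Fin Kc ↪ Fin K, (D.submatrix id e).det ≠ 0

theorem IsGeneric.eq_zero_of_mulVec_eq_zero {F : Type} [Field F] {Kc K : ℕ}
    {D : Matrix (Fin Kc) (Fin K) F} (hD : IsGeneric D) (hKc : 0 < Kc) (e : Fin 1 → Fin K)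
    (v : Fin 1 → F) (hv : (D.submatrix id e).mulVec v = 0) : v = 0 := by
  funext x
  have h := congrFun hv ⟨0, hKc⟩
  rw [Subsingleton.elim x 0]
  simpa [Matrix.mulVec, dotProduct, hD.1] using h

theorem isGeneric_of_eval_ne_zero {F : Type} [Field F] {Kc K : ℕ} {D : Matrix (Fin Kc) (Fin K) F}
    {p : Empty → F} (h : eval (Sum.elim (fun x => D x.1 x.2) p)
      (map (Int.castRingHom F) (genericPolynomial Kc K)) ≠ 0) : IsGeneric D := by
  simp only [genericPolynomial, map_mul, map_prod, map_X, eval_X, Sum.elim_inl] at h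
  refine ⟨fun i k =>
    Finset.prod_ne_zero_iff.1 (left_ne_zero_of_mul h) (i, k) (Finset.mem_univ _), fun e => ?_⟩
  have h1 := Finset.prod_ne_zero_iff.1 (right_ne_zero_of_mul h) e (Finset.mem_univ _)
  rw [RingHom.map_det, RingHom.map_det] at h1
  convert h1
  refine Matrix.ext fun i j => ?_
  simp

theorem uniformProb_not_isGeneric_le (F : Type) [Field F] [Finite F] (Kc K : ℕ) :
    uniformProb {D : Matrix (Fin Kc) (Fin K) F | ¬ IsGeneric D} ≤
      ((genericPolynomial Kc K).totalDegree : ℝ) / Nat.card F := by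
  have : Finite (Matrix (Fin Kc) (Fin K) F) := inferInstanceAs (Finite (Fin Kc → Fin K → F))
  calc _ ≤ uniformProb {D : Matrix (Fin Kc) (Fin K) F | ∀ p : Empty → F,
        eval (Sum.elim (fun x => D x.1 x.2) p)
          (map (Int.castRingHom F) (genericPolynomial Kc K)) = 0} := by
        refine uniformProb_mono fun D hD p => ?_
        by_contra h
        exact hD (isGeneric_of_eval_ne_zero h)
    _ ≤ _ := uniformProb_forall_eval_eq_zero_le _ (map_genericPolynomial_ne_zero Kc K F)
    _ ≤ _ := by
        gcongr
        exact Finset.sup_mono (support_map_subset _ _)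

/-- If the error events `E i` are rare and most `D` satisfy `G`, then some `D` satisfying `G` has
conditional error probabilities less than one half. -/
theorem exists_of_uniformProb_le {α β I : Type} [Finite α] [Finite β] [Fintype I] [Nonempty α]
    [Nonempty β] (G : α → Prop) (E : I → Set (α × β)) {δ : ℝ}
    (hG : uniformProb {a | ¬ G a} ≤ 1 / 2) (hE : ∀ i, uniformProb (E i) ≤ δ)
    (hδ : Fintype.card I * δ < 1 / 4) :
    ∃ a, G a ∧ ∀ i, 2 * {b | (a, b) ∈ E i}.ncard < Nat.card β := by
  classical
  have := Fintype.ofFinite α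
  have := Fintype.ofFinite β
  by_contra! hcon
  have hfib : ∀ i, ∑ a, {b | (a, b) ∈ E i}.ncard = (E i).ncard := by
    intro i
    have h1 : (E i).ncard = ∑ x : α × β, if x ∈ E i then 1 else 0 := by
      rw [← Finset.card_filter, ← Set.ncard_coe_finset]; simp
    rw [h1, Fintype.sum_prod_type]
    refine Finset.sum_congr rfl fun a _ => ?_
    rw [← Finset.card_filter, ← Set.ncard_coe_finset]; simp
  have hα : (0 : ℝ) < Nat.card α := by exact_mod_cast Nat.card_pos
  have hβ : (0 : ℝ) < Nat.card β := by exact_mod_cast Nat.card_pos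
  -- If the claim fails, every good `a` carries error mass at least half of `β`, for a total of at
  -- least a quarter of `α × β`, against `hδ`.
  have h1 : ∀ a, Nat.card β * (if G a then 1 else 0) ≤ 2 * ∑ i, {b | (a, b) ∈ E i}.ncard := by
    intro a
    split_ifs with ha
    · obtain ⟨i, hi⟩ := hcon a ha
      have h2 := Finset.single_le_sum (f := fun i => {b | (a, b) ∈ E i}.ncard)
        (fun _ _ => Nat.zero_le _) (Finset.mem_univ i)
      omega
    · simp
  have h2 : Nat.card β * {a | G a}.ncard ≤ 2 * ∑ i, (E i).ncard := by
    have h3 := Finset.sum_le_sum fun a (_ : a ∈ Finset.univ) => h1 a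
    rw [← Finset.mul_sum, ← Finset.mul_sum, ← Finset.card_filter, Finset.sum_comm] at h3
    simp only [hfib] at h3
    have h4 : {a | G a}.ncard = (Finset.univ.filter G).card := by
      rw [← Set.ncard_coe_finset]; simp
    rwa [h4]
  have h3 : ∀ i, ((E i).ncard : ℝ) ≤ δ * (Nat.card α * Nat.card β) := by
    intro i
    have := hE i
    unfold uniformProb at this
    rw [Nat.card_prod, div_le_iff₀ (by push_cast; positivity)] at this
    push_cast at this
    exact this
  have h4 : ((∑ i, (E i).ncard : ℕ) : ℝ) ≤ Fintype.card I * (δ * (Nat.card α * Nat.card β)) := by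
    push_cast
    calc _ ≤ ∑ _i : I, δ * ((Nat.card α : ℝ) * Nat.card β) := Finset.sum_le_sum fun i _ => h3 i
      _ = _ := by simp
  have h5 : (Nat.card α : ℝ) = {a | G a}.ncard + {a | ¬ G a}.ncard := by
    have := Set.ncard_add_ncard_compl {a | G a}
    rw [← this]
    push_cast
    rfl
  have h6 : ({a | ¬ G a}.ncard : ℝ) ≤ 1 / 2 * Nat.card α := by
    unfold uniformProb at hG
    rwa [div_le_iff₀ hα] at hG
  have h7 : (Nat.card β : ℝ) * {a | G a}.ncard ≤ 2 * ((∑ i, (E i).ncard : ℕ) : ℝ) := by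
    exact_mod_cast h2
  have h8 : (Nat.card β : ℝ) * (1 / 2 * Nat.card α) ≤ Nat.card β * {a | G a}.ncard :=
    mul_le_mul_of_nonneg_left (by linarith) hβ.le
  have h9 : 0 < (Nat.card α : ℝ) * Nat.card β := by positivity
  nlinarith

/-- The messages on which the output of a scheme is wrong. -/
def Scheme.errorSet {F : Type} [Field F] {K N Kc M L : ℕ} (s : Scheme F K N Kc M L)
    (A : Finset (Fin N)) (D : Matrix (Fin Kc) (Fin K) F) : Set (Matrix (Fin K) (Fin L) F) :=
  {W | s.output A D W ≠ D * W}

theorem exists_isGeneric_of_achievable {K N Nr Kc M : ℕ} {R : ℝ} (h : Achievable K N Nr Kc M R) :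
    ∃ (L : ℕ) (F : Type) (_ : Field F) (_ : Finite F) (s : Scheme F K N Kc M L)
      (D : Matrix (Fin Kc) (Fin K) F), 0 < L ∧ s.commCost Nr ≤ R ∧ IsGeneric D ∧
        ∀ A : Finset (Fin N), A.card = Nr →
          2 * (s.errorSet A D).ncard < Nat.card (Matrix (Fin K) (Fin L) F) := by
  classical
  obtain ⟨L, hL, s, hs, herr⟩ := h
  let c : ℝ := Fintype.card {A : Finset (Fin N) // A.card = Nr}
  have hc : 0 ≤ c := Nat.cast_nonneg _
  -- The sum of the errors over all `c` responder sets stays below a quarter; `c + 1` avoids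
  -- division by zero.
  let δ : ℝ := 1 / (4 * (c + 1))
  have hδ : 0 < δ := by positivity
  obtain ⟨Q, hQ⟩ := herr δ hδ
  obtain ⟨p, hp, hpp⟩ := Nat.exists_infinite_primes
    (max Q (2 * (genericPolynomial Kc K).totalDegree))
  have : Fact p.Prime := ⟨hpp⟩
  have hcard : Nat.card (ZMod p) = p := Nat.card_zmod p
  have : Finite (Matrix (Fin Kc) (Fin K) (ZMod p)) :=
    inferInstanceAs (Finite (Fin Kc → Fin K → ZMod p))
  have : Finite (Matrix (Fin K) (Fin L) (ZMod p)) :=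
    inferInstanceAs (Finite (Fin K → Fin L → ZMod p))
  have hE := hQ (ZMod p) (by rw [hcard]; exact le_trans (le_max_left _ _) hp)
  have hG := uniformProb_not_isGeneric_le (ZMod p) Kc K
  have hG' : ((genericPolynomial Kc K).totalDegree : ℝ) / Nat.card (ZMod p) ≤ 1 / 2 := by
    have h0 : (0 : ℝ) < p := by exact_mod_cast hpp.pos
    have h1 : ((2 * (genericPolynomial Kc K).totalDegree : ℕ) : ℝ) ≤ p := by
      exact_mod_cast le_trans (le_max_right _ _) hp
    rw [hcard, div_le_iff₀ h0]
    push_cast at h1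
    linarith
  obtain ⟨D, hD, hDE⟩ := exists_of_uniformProb_le
    (fun D : Matrix (Fin Kc) (Fin K) (ZMod p) => IsGeneric D)
    (fun A : {A : Finset (Fin N) // A.card = Nr} =>
      {x : Matrix (Fin Kc) (Fin K) (ZMod p) × Matrix (Fin K) (Fin L) (ZMod p) |
        (s (ZMod p)).output A.1 x.1 x.2 ≠ x.1 * x.2}) (hG.trans hG')
    (fun A => (le_ciSup (Set.finite_range _).bddAbove A).trans hE) (by
      change c * (1 / (4 * (c + 1))) < 1 / 4
      rw [mul_one_div, div_lt_div_iff₀ (by positivity) (by norm_num)]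
      linarith)
  exact ⟨L, ZMod p, inferInstance, inferInstance, s (ZMod p), D, hL, hs (ZMod p), hD,
    fun A hA => hDE ⟨A, hA⟩⟩

/-! ### Lower bounds by counting answers. -/

theorem Scheme.answer_congr {F : Type} {K N Kc M L : ℕ} (s : Scheme F K N Kc M L)
    (D : Matrix (Fin Kc) (Fin K) F) {W W' : Matrix (Fin K) (Fin L) F} {n : Fin N}
    (h : ∀ k ∈ s.assign n D, W k = W' k) : s.answer D W n = s.answer D W' n := by
  unfold Scheme.answer
  congr 1
  funext k hk
  exact h k hk

/-- If the messages can vary along `E` so that the product `D * W` varies injectively while only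
the workers in `B` notice, then these workers send about `log |U|` symbols. -/
theorem Scheme.card_lt_of_errorSet {F : Type} [Field F] [Finite F] {K N Kc M L : ℕ}
    (s : Scheme F K N Kc M L) (A B : Finset (Fin N)) (D : Matrix (Fin Kc) (Fin K) F)
    {U : Type} [Finite U] [Nonempty U] (E : U → Matrix (Fin K) (Fin L) F)
    (hE : Function.Injective fun u => D * E u)
    (hB : ∀ n ∈ A, n ∉ B → ∀ u, ∀ k ∈ s.assign n D, E u k = 0)
    (herr : 2 * (s.errorSet A D).ncard < Nat.card (Matrix (Fin K) (Fin L) F)) :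
    Nat.card U < 2 * Nat.card F ^ (∑ n ∈ B, s.len n) := by
  classical
  have := Fintype.ofFinite F
  have := Fintype.ofFinite U
  have : Finite (Matrix (Fin K) (Fin L) F) := inferInstanceAs (Finite (Fin K → Fin L → F))
  have := Fintype.ofFinite (Matrix (Fin K) (Fin L) F)
  simp only [Nat.card_eq_fintype_card] at herr ⊢
  have herr' : (s.errorSet A D).ncard = ∑ W, if W ∈ s.errorSet A D then 1 else 0 := by
    rw [← Finset.card_filter, ← Set.ncard_coe_finset]; simp
  -- Translation by each `E u` permutes the messages, so averaging over `W` gives a base point where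
  -- fewer than half of the `u` lead to an error.
  obtain ⟨W, hW⟩ : ∃ W, 2 * (∑ u, if W + E u ∈ s.errorSet A D then 1 else 0) < Fintype.card U := by
    by_contra! hcon
    have h1 := Finset.sum_le_sum fun W (_ : W ∈ Finset.univ) => hcon W
    rw [Finset.sum_const, Finset.card_univ, ← Finset.mul_sum, Finset.sum_comm] at h1
    have h2 : ∀ u, (∑ W, if W + E u ∈ s.errorSet A D then 1 else 0) =
        (s.errorSet A D).ncard := by
      intro u
      rw [herr']
      exact Equiv.sum_comp (Equiv.addRight (E u)) fun W => if W ∈ s.errorSet A D then 1 else 0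
    simp only [h2, Finset.sum_const, Finset.card_univ, smul_eq_mul] at h1
    have h3 : 0 < Fintype.card U := Fintype.card_pos
    nlinarith
  rw [← Finset.card_filter] at hW
  have hsplit := Finset.card_filter_add_card_filter_not (s := (Finset.univ : Finset U))
    (fun u => W + E u ∈ s.errorSet A D)
  rw [Finset.card_univ] at hsplit
  -- Among correctly decoded `u`, the answers of `B` fix all answers, hence the product, hence `u`.
  have hgood : (Finset.univ.filter fun u => ¬ W + E u ∈ s.errorSet A D).card ≤
      Fintype.card ((n : B) → Fin (s.len n) → F) := by
    rw [← Finset.card_univ]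
    refine Finset.card_le_card_of_injOn (fun u n => s.answer D (W + E u) n)
      (fun _ _ => Finset.mem_coe.2 (Finset.mem_univ _)) ?_
    intro u hu u' hu' huu
    have hans : ∀ n ∈ A, s.answer D (W + E u) n = s.answer D (W + E u') n := by
      intro n hn
      by_cases hnB : n ∈ B
      · exact congrFun huu ⟨n, hnB⟩
      · refine s.answer_congr D fun k hk => ?_
        change W k + E u k = W k + E u' k
        rw [hB n hn hnB u k hk, hB n hn hnB u' k hk]
    have hout : s.output A D (W + E u) = s.output A D (W + E u') := by
      unfold Scheme.output
      congr 1
      funext n hn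
      exact hans n hn
    have hu1 : s.output A D (W + E u) = D * (W + E u) :=
      not_not.1 (Finset.mem_filter.1 (Finset.mem_coe.1 hu)).2
    have hu2 : s.output A D (W + E u') = D * (W + E u') :=
      not_not.1 (Finset.mem_filter.1 (Finset.mem_coe.1 hu')).2
    rw [hu1, hu2, Matrix.mul_add, Matrix.mul_add] at hout
    exact hE (add_left_cancel hout)
  have hcardpi : Fintype.card ((n : B) → Fin (s.len n) → F) =
      Fintype.card F ^ (∑ n ∈ B, s.len n) := by
    simp only [Fintype.card_pi, Finset.prod_const, Finset.card_univ, Fintype.card_fin]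
    rw [← Finset.prod_pow_eq_pow_sum]
    exact Finset.prod_coe_sort B fun n => Fintype.card F ^ s.len n
  rw [hcardpi] at hgood
  omega

/-- Only the messages listed by `e` are varied. The factor two lost to decoding errors is at most
the field order, so it cannot offset a deficit of a whole symbol. -/
theorem Scheme.mul_le_sum_len {F : Type} [Field F] [Finite F] {K N Kc M L : ℕ}
    (s : Scheme F K N Kc M L) (A B : Finset (Fin N)) (D : Matrix (Fin Kc) (Fin K) F)
    {c : ℕ} (e : Fin c ↪ Fin K) (he : ∀ v, (D.submatrix id e).mulVec v = 0 → v = 0)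
    (hB : ∀ n ∈ A, n ∉ B → ∀ x, e x ∉ s.assign n D)
    (herr : 2 * (s.errorSet A D).ncard < Nat.card (Matrix (Fin K) (Fin L) F)) :
    c * L ≤ ∑ n ∈ B, s.len n := by
  classical
  have : Finite (Matrix (Fin c) (Fin L) F) := inferInstanceAs (Finite (Fin c → Fin L → F))
  let P : Matrix (Fin K) (Fin c) F := (1 : Matrix (Fin K) (Fin K) F).submatrix id e
  have hDP : D * P = D.submatrix id e := by
    ext i x
    simp [P, Matrix.mul_apply, Matrix.one_apply]
  have h := s.card_lt_of_errorSet A B D (U := Matrix (Fin c) (Fin L) F) (fun u => P * u) ?_ ?_ herr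
  · have hcard : Nat.card (Matrix (Fin c) (Fin L) F) = Nat.card F ^ (c * L) := by
      unfold Matrix
      rw [Nat.card_fun, Nat.card_fun, Nat.card_fin, Nat.card_fin, ← pow_mul, mul_comm]
    rw [hcard] at h
    by_contra! hlt
    have h2 : 2 ≤ Nat.card F := Finite.one_lt_card
    have h3 : Nat.card F ^ (∑ n ∈ B, s.len n + 1) ≤ Nat.card F ^ (c * L) :=
      Nat.pow_le_pow_right (by omega) hlt
    rw [pow_succ] at h3
    have h4 := Nat.mul_le_mul_left (Nat.card F ^ (∑ n ∈ B, s.len n)) h2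
    omega
  · intro u u' huu
    simp only [← Matrix.mul_assoc, hDP] at huu
    ext x l
    have h1 := he (fun x => u x l - u' x l) (by
      funext i
      have h2 := congrFun (congrFun huu i) l
      simp only [Matrix.mul_apply] at h2
      simp only [Matrix.mulVec, dotProduct, mul_sub, Finset.sum_sub_distrib, h2, sub_self,
        Pi.zero_apply])
    exact sub_eq_zero.1 (congrFun h1 x)
  · intro n hn hnB u k hk
    funext l
    simp only [Matrix.mul_apply, Pi.zero_apply]
    refine Finset.sum_eq_zero fun x _ => ?_
    have hne : k ≠ e x := fun h => hB n hn hnB x (h ▸ hk)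
    simp [P, hne]

/-- In an assignment of minimum size in which any `t + 1` workers cover all datasets, each worker
`n` belongs to a set `A` of `t + 1` workers in which `n` alone holds some `c + 1` datasets. -/
theorem exists_private_datasets {N t m c : ℕ} (ht : t < N) (hc : c * N.choose (N - t) < N * m)
    (Z : Fin N → Finset (Fin (N * m))) (hZ : ∀ n, (Z n).card ≤ (N - t) * m)
    (hcov : ∀ A : Finset (Fin N), A.card = t + 1 → ∀ k, ∃ n ∈ A, k ∈ Z n) (n : Fin N) :
    ∃ (e : Fin (c + 1) ↪ Fin (N * m)) (A : Finset (Fin N)), A.card = t + 1 ∧ n ∈ A ∧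
      ∀ n' ∈ A, n' ≠ n → ∀ x, e x ∉ Z n' := by
  classical
  let H : Fin (N * m) → Finset (Fin N) := fun k => Finset.univ.filter fun n => k ∈ Z n
  have hH : ∀ k, N - t ≤ (H k).card := by
    intro k
    by_contra! hlt
    have h1 : t + 1 ≤ (H k)ᶜ.card := by
      rw [Finset.card_compl, Fintype.card_fin]; omega
    obtain ⟨A, hA, hAc⟩ := Finset.exists_subset_card_eq h1
    obtain ⟨n, hn, hk⟩ := hcov A hAc k
    have h2 := hA hn
    simp [H, hk] at h2
  have hsum : ∑ k, (H k).card = ∑ n, (Z n).card := by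
    have h1 : ∀ n, (Z n).card = ∑ k, if k ∈ Z n then 1 else 0 := fun n => by
      rw [← Finset.card_filter]; simp
    simp only [h1, H, Finset.card_filter]
    exact Finset.sum_comm
  have hle1 : ∑ _k : Fin (N * m), (N - t) ≤ ∑ k, (H k).card := Finset.sum_le_sum fun k _ => hH k
  have hle2 : ∑ n, (Z n).card ≤ ∑ _n : Fin N, (N - t) * m := Finset.sum_le_sum fun n _ => hZ n
  -- The two ends of the double count agree, so every termwise inequality is an equality.
  have hconst : ∑ _k : Fin (N * m), (N - t) = ∑ _n : Fin N, (N - t) * m := by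
    simp; ring
  have hHeq : ∀ k, (H k).card = N - t := fun k =>
    ((Finset.sum_eq_sum_iff_of_le fun k _ => hH k).1 (by omega) k (Finset.mem_univ k)).symm
  have hZeq : ∀ n, (Z n).card = (N - t) * m := fun n =>
    (Finset.sum_eq_sum_iff_of_le fun n _ => hZ n).1 (by omega) n (Finset.mem_univ n)
  -- The possible holder sets of a dataset of worker `n`; the pigeonhole finds one shared by `c + 1`
  -- datasets.
  let T : Finset (Finset (Fin N)) :=
    ((Finset.univ.erase n).powersetCard (N - t - 1)).image (insert n)
  have hmaps : ∀ k ∈ Z n, H k ∈ T := by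
    intro k hk
    have hn : n ∈ H k := by simp [H, hk]
    refine Finset.mem_image.2 ⟨(H k).erase n, Finset.mem_powersetCard.2
      ⟨Finset.erase_subset_erase _ (Finset.subset_univ _), ?_⟩, Finset.insert_erase hn⟩
    rw [Finset.card_erase_of_mem hn, hHeq]
  have hTcard : T.card * c < (Z n).card := by
    have h1 : T.card ≤ (N - 1).choose (N - t - 1) := by
      refine Finset.card_image_le.trans ?_
      rw [Finset.card_powersetCard, Finset.card_erase_of_mem (Finset.mem_univ _),
        Finset.card_univ, Fintype.card_fin]
    have h2 : N * (N - 1).choose (N - t - 1) = N.choose (N - t) * (N - t) := by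
      have := Nat.add_one_mul_choose_eq (N - 1) (N - t - 1)
      rwa [show N - 1 + 1 = N by omega, show N - t - 1 + 1 = N - t by omega] at this
    rw [hZeq]
    have h3 : c * N.choose (N - t) * (N - t) < N * m * (N - t) :=
      Nat.mul_lt_mul_of_pos_right hc (by omega)
    have h4 : N * ((N - 1).choose (N - t - 1) * c) < N * ((N - t) * m) := by
      calc _ = c * (N * (N - 1).choose (N - t - 1)) := by ring
        _ = c * N.choose (N - t) * (N - t) := by rw [h2]; ring
        _ < N * m * (N - t) := h3
        _ = _ := by ring
    exact lt_of_le_of_lt (Nat.mul_le_mul_right c h1) (Nat.lt_of_mul_lt_mul_left h4)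
  obtain ⟨S, hS, hSc⟩ := Finset.exists_lt_card_fiber_of_mul_lt_card_of_maps_to hmaps hTcard
  obtain ⟨I, hI, hIc⟩ := Finset.exists_subset_card_eq (Nat.succ_le_of_lt hSc)
  have hnS : n ∈ S := by
    obtain ⟨S', _, rfl⟩ := Finset.mem_image.1 hS
    exact Finset.mem_insert_self _ _
  have hIS : ∀ k ∈ I, H k = S := fun k hk => (Finset.mem_filter.1 (hI hk)).2
  -- The responders are `n` and all the non-holders, `t + 1` workers in total.
  refine ⟨(I.orderEmbOfFin hIc).toEmbedding, insert n Sᶜ, ?_, Finset.mem_insert_self _ _,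
    fun n' hn' hne x hx => ?_⟩
  · rw [Finset.card_insert_of_notMem (by simpa using hnS), Finset.card_compl, Fintype.card_fin]
    have hScard : S.card = N - t := by
      have : 0 < I.card := by rw [hIc]; omega
      obtain ⟨k, hk⟩ := Finset.card_pos.1 this
      rw [← hIS k hk, hHeq]
    omega
  · have h1 : n' ∉ S := by
      rcases Finset.mem_insert.1 hn' with h | h
      · exact absurd h hne
      · simpa using h
    have h2 := hIS _ (I.orderEmbOfFin_mem hIc x)
    apply h1
    rw [← h2]
    simpa [H] using hx

theorem Scheme.sum_len_le {F : Type} {K N Kc M L Nr : ℕ} (s : Scheme F K N Kc M L) (hL : 0 < L)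
    {R : ℝ} (h : s.commCost Nr ≤ R) {A : Finset (Fin N)} (hA : A.card = Nr) :
    ((∑ n ∈ A, s.len n : ℕ) : ℝ) ≤ R * L := by
  have h1 : (∑ n ∈ A, (s.len n : ℝ)) / (L : ℝ) ≤ s.commCost Nr :=
    le_ciSup (f := fun A : {A : Finset (Fin N) // A.card = Nr} =>
      (∑ n ∈ A.1, (s.len n : ℝ)) / (L : ℝ)) (Set.finite_range _).bddAbove ⟨A, hA⟩
  have h2 := h1.trans h
  rw [div_le_iff₀ (by exact_mod_cast hL)] at h2
  push_cast
  exact h2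

theorem request_card_le_of_achievable {K N Nr Kc M : ℕ} (hNr : Nr ≤ N) (hKc : Kc ≤ K) {R : ℝ}
    (h : Achievable K N Nr Kc M R) : (Kc : ℝ) ≤ R := by
  obtain ⟨L, F, _, _, s, D, hL, hs, hD, herr⟩ := exists_isGeneric_of_achievable h
  obtain ⟨A, -, hA⟩ := Finset.exists_subset_card_eq
    (show Nr ≤ (Finset.univ : Finset (Fin N)).card by simpa using hNr)
  have h1 := s.mul_le_sum_len A A D (Fin.castLEEmb hKc)
    (fun v hv => Matrix.eq_zero_of_mulVec_eq_zero (hD.2 _) hv)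
    (fun n hn hn' => absurd hn hn') (herr A hA)
  have h2 := s.sum_len_le hL hs hA
  have h3 : ((Kc * L : ℕ) : ℝ) ≤ R * L := le_trans (by exact_mod_cast h1) h2
  push_cast at h3
  exact le_of_mul_le_mul_right h3 (by exact_mod_cast hL)

/-- If generic request matrices have linearly independent columns at any `c + 1` places, and each
worker is forced to have `c + 1` private datasets, then each worker sends at least `c + 1` symbols
per message symbol. -/
theorem mul_le_of_achievable {N t m Kc c : ℕ} (ht : t < N) (hKc : 0 < Kc)
    (hc : c * N.choose (N - t) < N * m)
    (hinj : ∀ (F : Type) [Field F] (D : Matrix (Fin Kc) (Fin (N * m)) F), IsGeneric D →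
      ∀ (e : Fin (c + 1) ↪ Fin (N * m)) v, (D.submatrix id e).mulVec v = 0 → v = 0)
    {R : ℝ} (h : Achievable (N * m) N (t + 1) Kc ((N - t) * m) R) :
    ((t + 1 : ℕ) : ℝ) * ((c + 1 : ℕ) : ℝ) ≤ R := by
  obtain ⟨L, F, _, _, s, D, hL, hs, hD, herr⟩ := exists_isGeneric_of_achievable h
  have hcov : ∀ A : Finset (Fin N), A.card = t + 1 → ∀ k, ∃ n ∈ A, k ∈ s.assign n D := by
    intro A hA k
    by_contra! hk
    -- An uncovered dataset would have to be conveyed by no worker at all, forcing `L ≤ 0`.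
    have h1 := s.mul_le_sum_len A ∅ D (c := 1) ⟨fun _ => k, fun _ _ _ => Subsingleton.elim _ _⟩
      (fun v hv => hD.eq_zero_of_mulVec_eq_zero hKc _ v hv)
      (fun n hn _ _ => hk n hn) (herr A hA)
    simp at h1
    omega
  have hlen : ∀ n, (c + 1) * L ≤ s.len n := by
    intro n
    obtain ⟨e, A, hA, hn, he⟩ := exists_private_datasets ht hc (fun n => s.assign n D)
      (fun n => s.card_assign_le n D) hcov n
    have h1 := s.mul_le_sum_len A {n} D e (hinj F D hD e)
      (fun n' hn' hne => he n' hn' (by simpa using hne)) (herr A hA)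
    simpa using h1
  obtain ⟨A, -, hA⟩ := Finset.exists_subset_card_eq
    (show t + 1 ≤ (Finset.univ : Finset (Fin N)).card by simpa using ht)
  have h1 : (t + 1) * ((c + 1) * L) ≤ ∑ n ∈ A, s.len n := by
    rw [← hA, ← smul_eq_mul]
    exact Finset.card_nsmul_le_sum _ _ _ fun n _ => hlen n
  have h2 := s.sum_len_le hL hs hA
  have h3 : (((t + 1) * ((c + 1) * L) : ℕ) : ℝ) ≤ R * L := le_trans (by exact_mod_cast h1) h2
  refine le_of_mul_le_mul_right (le_trans (le_of_eq ?_) h3) (by exact_mod_cast hL : (0 : ℝ) < L)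
  push_cast
  ring

theorem mul_request_card_le_of_achievable {N t m Kc : ℕ} (ht : t < N) (hKc : 0 < Kc)
    (hc : (Kc - 1) * N.choose (N - t) < N * m) {R : ℝ}
    (h : Achievable (N * m) N (t + 1) Kc ((N - t) * m) R) :
    ((t + 1 : ℕ) : ℝ) * (Kc : ℝ) ≤ R := by
  obtain ⟨c, rfl⟩ := Nat.exists_eq_succ_of_ne_zero hKc.ne'
  exact mul_le_of_achievable ht hKc hc
    (fun F _ D hD e v hv => Matrix.eq_zero_of_mulVec_eq_zero (hD.2 e) hv) h

theorem card_workers_le_of_achievable {N t m Kc : ℕ} (ht : t < N) (hKc : 0 < Kc) (hm : 0 < m)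
    {R : ℝ}
    (h : Achievable (N * m) N (t + 1) Kc ((N - t) * m) R) : ((t + 1 : ℕ) : ℝ) ≤ R := by
  have hpos : 0 < N * m := Nat.mul_pos (by omega) hm
  simpa using mul_le_of_achievable (c := 0) ht hKc (by simpa using hpos)
    (fun F _ D hD e v hv => hD.eq_zero_of_mulVec_eq_zero hKc e v hv) h

end LinSepComp

end

/-! ### Assembly of the three cases. -/

theorem theorem3 (K N Nr Kc M : ℕ)
    (hNK : N ∣ K) (hNr : 1 ≤ Nr) (hNrN : Nr ≤ N) (hKc : 1 ≤ Kc) (hKcK : Kc ≤ K)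
    (hM : (M : ℚ) = (K : ℚ) / (N : ℚ) * ((N : ℚ) - (Nr : ℚ) + 1)) :
    (K = N →
      (Kc ≤ Nr → LinSepComp.IsMinCommCost K N Nr Kc M (Nr : ℝ)) ∧
      (Nr < Kc → LinSepComp.IsMinCommCost K N Nr Kc M (Kc : ℝ))) ∧
    (Kc ≤ ⌈(K : ℚ) / (N.choose (N - Nr + 1) : ℚ)⌉₊ →
      LinSepComp.IsMinCommCost K N Nr Kc M ((Nr : ℝ) * (Kc : ℝ))) ∧
    ((K : ℚ) / (N : ℚ) * (Nr : ℚ) ≤ (Kc : ℚ) →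
      LinSepComp.IsMinCommCost K N Nr Kc M (Kc : ℝ)) := by
  obtain ⟨m, rfl⟩ := hNK
  obtain ⟨t, rfl⟩ := Nat.exists_eq_succ_of_ne_zero (by omega : Nr ≠ 0)
  rw [Nat.succ_eq_add_one] at *
  have ht : t < N := hNrN
  have hN : (N : ℚ) ≠ 0 := by exact_mod_cast (by omega : N ≠ 0)
  have hm : 0 < m := by
    rcases Nat.eq_zero_or_pos m with h | h
    · subst h; omega
    · exact h
  have hdiv : ((N * m : ℕ) : ℚ) / (N : ℚ) = m := by
    push_cast; field_simp
  have hMeq : M = (N - t) * m := by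
    rw [hdiv] at hM
    have h1 : (M : ℚ) = (((N - t) * m : ℕ) : ℚ) := by
      rw [hM]
      push_cast [ht.le]
      ring
    exact_mod_cast h1
  subst hMeq
  have hchoose : N - (t + 1) + 1 = N - t := by omega
  -- This serves the last case and also `K = N` with `Nr < Kc`, where `m = 1`.
  have hself : (t + 1) * m ≤ Kc →
      LinSepComp.IsMinCommCost (N * m) N (t + 1) Kc ((N - t) * m) (Kc : ℝ) := fun h =>
    ⟨LinSepComp.achievable_self ht hm h le_rfl,
      fun R hR => LinSepComp.request_card_le_of_achievable hNrN hKcK hR⟩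
  refine ⟨fun hK => ?_, fun hc => ?_, fun hc => hself ?_⟩
  · have hm1 : m = 1 := by
      have : N * m = N * 1 := by omega
      exact Nat.eq_of_mul_eq_mul_left (by omega) this
    exact ⟨fun h => ⟨LinSepComp.achievable_of_le ht hm1 h le_rfl,
      fun R hR => LinSepComp.card_workers_le_of_achievable ht hKc hm hR⟩,
      fun h => hself (by rw [hm1]; omega)⟩
  · refine ⟨LinSepComp.achievable_mul ht le_rfl,
      fun R hR => LinSepComp.mul_request_card_le_of_achievable ht hKc ?_ hR⟩
    rw [hchoose] at hc
    have hpos : 0 < N.choose (N - t) := Nat.choose_pos (by omega)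
    have h1 : ((Kc - 1 : ℕ) : ℚ) < ((N * m : ℕ) : ℚ) / (N.choose (N - t) : ℚ) :=
      Nat.lt_ceil.1 (by omega)
    rw [lt_div_iff₀ (by exact_mod_cast hpos)] at h1
    exact_mod_cast h1
  · rw [hdiv] at hc
    have h1 : m * (t + 1) ≤ Kc := by exact_mod_cast hc
    rwa [mul_comm] at h1
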